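/- For integers $m,k\ge 1$ and $d\ge 1$, let $P_d^{m,k}$ denote the homogeneous Kostlan polynomial map $$P_d^{m,k}(x)=\sum_{\alpha\in\mathbb{N}^{m+1},\ |\alpha|=d}\xi_\alpha\, x_0^{\alpha_0}\cdots x_m^{\alpha_m},\qquad x=(x_0,\dots,x_m)\in\mathbb{R}^{m+1},$$ where the $\xi_\alpha$ are independent centered Gaussian random vectors in $\mathbb{R}^k$ and $\xi_\alpha$ has covariance matrix $\frac{d!}{\alpha_0!\cdots\alpha_m!}\,\mathbf{1}_k$. **Proposition.** Let $d\ge 1$ be an integer. 1. Let $X_d:\mathbb{R}^2\to\mathbb{R}^3$, $X_d(u)=P_d^{2,3}\bigl(1,\tfrac{u_1}{\sqrt d},\tfrac{u_2}{\sqrt d}\bigr)$, be the rescaled Kostlan map. Then the random map $k_d=X_d|_{\partial\mathbb{D}^2}:S^1\to\mathbb{R}^3$, its restriction to the unit circle $S^1=\partial\mathbb{D}^2\subset\mathbb{R}^2$, is almost surely a topological embedding (i.e. a knot). 2. Write $P_d^{1,4}=(p_0,p_1,p_2,p_3)$. Almost surely, $p_0,\dots,p_3$ have no common zero in $\mathbb{R}^2\setminus\{0\}$,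 and the random rational map $\varphi_d^{1,3}:\mathbb{R}\mathrm{P}^1\to\mathbb{R}\mathrm{P}^3$, $\varphi_d^{1,3}([x_0,x_1])=[p_0(x),p_1(x),p_2(x),p_3(x)]$, which is then well defined, is a smooth embedding, that is, a topological embedding which is smooth with injective differential at every point. -/

import Mathlib

open MeasureTheory ProbabilityTheory Topology
open scoped LinearAlgebra.Projectivization

noncomputable section

namespace RandomKnot

/-! ### Kostlan polynomial maps -/

/-- Multi-indices `α ∈ ℕ^(m+1)` with `|α| = α₀ + ⋯ + αₘ = d`. -/
abbrev MultiIndex (m d : ℕ) : Type :=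
  {α : Fin (m + 1) →₀ ℕ // α ∈ (Finset.univ : Finset (Fin (m + 1))).finsuppAntidiag d}

/-- The multinomial coefficient `d! / (α₀! ⋯ αₘ!)`. -/
def multinomialCoeff {m d : ℕ} (α : MultiIndex m d) : ℕ :=
  Nat.multinomial Finset.univ α.1

/-- `ξ` is a family of coefficients of a Kostlan polynomial map of type `(d, m, k)`: the `ξ_α`,
`|α| = d`, are independent centered Gaussian random vectors of `ℝᵏ`, and `ξ_α` has covariance
matrix `d! / (α₀! ⋯ αₘ!)` times the identity. -/
structure IsKostlanFamily {Ω : Type*} [MeasurableSpace Ω] (μ : Measure Ω) {m d k : ℕ}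
    (ξ : MultiIndex m d → Ω → EuclideanSpace ℝ (Fin k)) : Prop where
  indep : iIndepFun ξ μ
  hasLaw : ∀ α, HasLaw (ξ α)
    (multivariateGaussian 0 ((multinomialCoeff α : ℝ) • (1 : Matrix (Fin k) (Fin k) ℝ))) μ

/-- The homogeneous polynomial map `x ↦ ∑_{|α| = d} x^α c_α` with vector coefficients `c`. -/
def polyMap {m d k : ℕ} (c : MultiIndex m d → EuclideanSpace ℝ (Fin k)) (x : Fin (m + 1) → ℝ) :
    EuclideanSpace ℝ (Fin k) :=
  ∑ α : MultiIndex m d, (∏ i, x i ^ α.1 i) • c α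

/-- The rescaled map `u ↦ P(1, u₁ / √d, …, uₘ / √d)`, where `P = polyMap c`. -/
def rescaledMap {m d k : ℕ} (c : MultiIndex m d → EuclideanSpace ℝ (Fin k))
    (u : EuclideanSpace ℝ (Fin m)) : EuclideanSpace ℝ (Fin k) :=
  polyMap c (Fin.cons 1 fun i => u i / √(d : ℝ))

theorem polyMap_smul {m d k : ℕ} (c : MultiIndex m d → EuclideanSpace ℝ (Fin k)) (t : ℝ)
    (x : Fin (m + 1) → ℝ) : polyMap c (t • x) = t ^ d • polyMap c x := by
  unfold polyMap
  rw [Finset.smul_sum]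
  refine Finset.sum_congr rfl fun α _ => ?_
  have h : ∑ i, α.1 i = d := (Finset.mem_finsuppAntidiag.1 α.2).1
  rw [smul_smul]
  congr 1
  simp only [Pi.smul_apply, smul_eq_mul, mul_pow, Finset.prod_mul_distrib,
    Finset.prod_pow_eq_pow_sum, h]

/-! ### Real projective space -/

/-- Real projective space `ℝPⁿ`. -/
abbrev RealProj (n : ℕ) : Type := ℙ ℝ (Fin (n + 1) → ℝ)

/-- The quotient topology from `ℝⁿ⁺¹ \ {0}`. -/
instance (n : ℕ) : TopologicalSpace (RealProj n) :=
  inferInstanceAs (TopologicalSpace (Quotient (projectivizationSetoid ℝ (Fin (n + 1) → ℝ))))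

/-- The inverse of the `i`-th standard affine chart of `ℝPⁿ`:
`u ↦ [u₀ : ⋯ : 1 : ⋯ : uₙ₋₁]`, with the `1` at position `i`. -/
def affineParam {n : ℕ} (i : Fin (n + 1)) (u : Fin n → ℝ) : RealProj n :=
  Projectivization.mk ℝ (i.insertNth (α := fun _ => ℝ) 1 u) fun h => by
    have := congrFun h i
    simp at this

/-- The `j`-th standard affine chart of `ℝPⁿ`: `[y] ↦ (y_l / y_j)_{l ≠ j}`. It is meaningful
where `y_j ≠ 0`, that is, on the range of `affineParam j`. -/
def affineCoord {n : ℕ} (j : Fin (n + 1)) : RealProj n → (Fin n → ℝ) :=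
  Projectivization.lift (fun v l => v.1 (j.succAbove l) / v.1 j) fun a b t h => by
    have ht : t ≠ 0 := by
      rintro rfl
      exact a.2 (by simpa using h)
    funext l
    simp only [h, Pi.smul_apply, smul_eq_mul]
    exact mul_div_mul_left _ _ ht

/-- `f : ℝPᵐ → ℝPᵏ` is a smooth embedding: a topological embedding which, in the standard affine
charts of source and target, is smooth with injective differential at every point. -/
structure IsSmoothEmbedding {m k : ℕ} (f : RealProj m → RealProj k) : Prop where
  isEmbedding : IsEmbedding f
  contDiffAt : ∀ (i : Fin (m + 1)) (j : Fin (k + 1)) (u : Fin m → ℝ),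
    f (affineParam i u) ∈ Set.range (affineParam j) →
      ContDiffAt ℝ ((⊤ : ℕ∞) : WithTop ℕ∞) (fun v => affineCoord j (f (affineParam i v))) u
  injective_fderiv : ∀ (i : Fin (m + 1)) (j : Fin (k + 1)) (u : Fin m → ℝ),
    f (affineParam i u) ∈ Set.range (affineParam j) →
      Function.Injective (fderiv ℝ (fun v => affineCoord j (f (affineParam i v))) u)

/-- The map `ℝPᵐ → ℝPᵏ`, `[x] ↦ [p₀(x) : ⋯ : pₖ(x)]`, where `(p₀, …, pₖ) = polyMap c` has no
zero other than the origin. -/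
def rationalMap {m d k : ℕ} (c : MultiIndex m d → EuclideanSpace ℝ (Fin (k + 1)))
    (hc : ∀ x : Fin (m + 1) → ℝ, x ≠ 0 → polyMap c x ≠ 0) : RealProj m → RealProj k :=
  Projectivization.lift
    (fun v => Projectivization.mk ℝ (fun j => polyMap c v.1 j) fun h =>
      hc v.1 v.2 (by ext j; exact congrFun h j))
    fun a b t h => by
      rw [Projectivization.mk_eq_mk_iff']
      refine ⟨t ^ d, ?_⟩
      funext j
      simp [h, polyMap_smul]

end RandomKnot

end

/-! Every way to fail is a linear relation `∑ α, a p α • c α = 0` among the coefficient vectors,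
with scalars `a p ≠ 0` depending smoothly on a parameter `p`. For fixed `p` such relations cut out a
subspace of codimension `k`, so if `p` has fewer than `k` real parameters the bad coefficients form
a null set (`ae_forall_sum_smul_ne_zero`). The Kostlan law is absolutely continuous, so null sets
are harmless.

The counts are: double points on the circle, two angles, 2 < 3; common zeros in the plane, 2 < 4;
double points in projective space, two angles and a ratio, 3 < 4; critical points, a position and a
ratio, 2 < 4. Nontriviality `a p ≠ 0` comes from the monomials `x i ^ (d - 1) * x k`, which recover
a point up to scale. Since source and target are compact and Hausdorff, respectively, injectivity
and continuity give an embedding. -/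

namespace MeasureTheory.Measure

/-! ### Null sets and absolute continuity -/

/-- A finite product of absolutely continuous measures is absolutely continuous. -/
theorem AbsolutelyContinuous.pi_fin {n : ℕ} {α : Fin n → Type*} [∀ i, MeasurableSpace (α i)]
    {μ ν : ∀ i, Measure (α i)} [∀ i, SigmaFinite (μ i)] [∀ i, SigmaFinite (ν i)]
    (h : ∀ i, μ i ≪ ν i) : Measure.pi μ ≪ Measure.pi ν := by
  induction n with
  | zero => rw [Measure.pi_of_empty, Measure.pi_of_empty]
  | succ n ih =>
    have hμ := (measurePreserving_piFinSuccAbove μ 0).symm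
    have hν := (measurePreserving_piFinSuccAbove ν 0).symm
    rw [← hμ.map_eq, ← hν.map_eq]
    exact ((h 0).prod (ih fun j => h _)).map (MeasurableEquiv.measurable _)

/-- A finite product of absolutely continuous measures is absolutely continuous. -/
theorem AbsolutelyContinuous.pi {ι : Type*} [Fintype ι] {α : ι → Type*}
    [∀ i, MeasurableSpace (α i)] {μ ν : ∀ i, Measure (α i)} [∀ i, SigmaFinite (μ i)]
    [∀ i, SigmaFinite (ν i)] (h : ∀ i, μ i ≪ ν i) : Measure.pi μ ≪ Measure.pi ν := by
  let e := (Fintype.equivFin ι).symm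
  rw [← (measurePreserving_piCongrLeft μ e).map_eq, ← (measurePreserving_piCongrLeft ν e).map_eq]
  exact (AbsolutelyContinuous.pi_fin fun i => h (e i)).map (MeasurableEquiv.measurable _)

/-- The range of a `C¹` map from a space of smaller dimension is a null set. -/
theorem addHaar_range_eq_zero_of_finrank_lt {V F : Type*} [NormedAddCommGroup V] [NormedSpace ℝ V]
    [FiniteDimensional ℝ V] [NormedAddCommGroup F] [NormedSpace ℝ F] [FiniteDimensional ℝ F]
    [MeasurableSpace F] [BorelSpace F] (μ : Measure F) [μ.IsAddHaarMeasure] {f : V → F}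
    (hf : ContDiff ℝ 1 f) (h : Module.finrank ℝ V < Module.finrank ℝ F) :
    μ (Set.range f) = 0 := by
  -- Hausdorff measure in the top dimension is a Haar measure, so a bound on the Hausdorff dimension
  -- of the range suffices.
  have := isAddHaarMeasure_hausdorffMeasure (E := F)
  have hac := Measure.absolutelyContinuous_isAddHaarMeasure μ
    (Measure.hausdorffMeasure (X := F) (Module.finrank ℝ F))
  refine measure_zero_of_dimH_lt (d := (Module.finrank ℝ F : NNReal)) (by simpa using hac) ?_
  exact hf.dimH_range_le.trans_lt (by exact_mod_cast h)

end MeasureTheory.Measure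

/-! ### Gaussian laws -/

namespace ProbabilityTheory

theorem stdGaussian_absolutelyContinuous {ι : Type*} [Fintype ι] :
    stdGaussian (EuclideanSpace ℝ ι) ≪ volume := by
  rw [← map_pi_eq_stdGaussian, ← (PiLp.volume_preserving_toLp ι).map_eq]
  refine Measure.AbsolutelyContinuous.map ?_ (by fun_prop)
  exact Measure.AbsolutelyContinuous.pi fun _ =>
    gaussianReal_absolutelyContinuous 0 one_ne_zero

/-- A nondegenerate multivariate Gaussian measure is absolutely continuous. -/
theorem multivariateGaussian_absolutelyContinuous {ι : Type*} [Fintype ι] [DecidableEq ι]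
    (m : EuclideanSpace ℝ ι) {S : Matrix ι ι ℝ} (hS : S.PosDef) :
    multivariateGaussian m S ≪ volume := by
  open scoped MatrixOrder in
  have hsq : CFC.sqrt S * CFC.sqrt S = S := CFC.sqrt_mul_sqrt_self _ hS.posSemidef.nonneg
  set A := Matrix.toEuclideanCLM (𝕜 := ℝ) (CFC.sqrt S) with hA
  have hdet : IsUnit (CFC.sqrt S).det := by
    have : IsUnit ((CFC.sqrt S).det * (CFC.sqrt S).det) := by
      rw [← Matrix.det_mul, hsq]
      exact hS.det_pos.ne'.isUnit
    exact isUnit_of_mul_isUnit_left this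
  have hunit : IsUnit A :=
    ((Matrix.isUnit_iff_isUnit_det _).2 hdet).map (Matrix.toEuclideanCLM (n := ι) (𝕜 := ℝ))
  have hAdet : A.det ≠ 0 := by
    have : IsUnit (A : EuclideanSpace ℝ ι →ₗ[ℝ] EuclideanSpace ℝ ι) :=
      hunit.map (ContinuousLinearMap.toLinearMapRingHom)
    exact (this.map LinearMap.det).ne_zero
  -- The law is the image of the standard Gaussian under `x ↦ m + A x`, with `A` invertible.
  have hq := (measurePreserving_add_left volume m).quasiMeasurePreserving.comp
    (Measure.ContinuousLinearMap.quasiMeasurePreserving volume A hAdet)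
  exact (stdGaussian_absolutelyContinuous.map hq.measurable).trans hq.absolutelyContinuous

end ProbabilityTheory

/-! ### Dimension count for linear relations -/

/-- If the parameter space has smaller dimension than `E`, then for almost every `c : ι → E` the
linear combinations `∑ i, a p i • c i` with smooth coefficients `a p ≠ 0` never vanish. -/
theorem ae_forall_sum_smul_ne_zero {ι V E : Type*} [Fintype ι]
    [NormedAddCommGroup V] [NormedSpace ℝ V] [FiniteDimensional ℝ V] [NormedAddCommGroup E]
    [NormedSpace ℝ E] [FiniteDimensional ℝ E] [MeasurableSpace E] [BorelSpace E]
    (μ : Measure (ι → E)) [μ.IsAddHaarMeasure] {a : V → ι → ℝ} (ha : ContDiff ℝ 1 a)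
    (hdim : Module.finrank ℝ V < Module.finrank ℝ E) :
    ∀ᵐ c ∂μ, ∀ p, a p ≠ 0 → ∑ i, a p i • c i ≠ 0 := by
  classical
  have ha' (i : ι) : ContDiff ℝ 1 fun p => a p i := contDiff_pi.1 ha i
  -- Solving the relation for `c k` would divide by `a p k`. Writing `c i = a p k • b i` for `i ≠ k`
  -- gives `c k = -∑ a p j • b j`, which is smooth on all of `V`.
  let F (k : ι) (q : V × ({i // i ≠ k} → E)) (i : ι) : E :=
    if h : i = k then -∑ j : {i // i ≠ k}, a q.1 j • q.2 j else a q.1 k • q.2 ⟨i, h⟩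
  have hF (k : ι) : ContDiff ℝ 1 (F k) := by
    refine contDiff_pi.2 fun i => ?_
    by_cases h : i = k
    · simp only [F, h, dite_true]
      fun_prop
    · simp only [F, h, dite_false]
      fun_prop
  have hnull (k : ι) : μ (Set.range (F k)) = 0 := by
    refine Measure.addHaar_range_eq_zero_of_finrank_lt μ (hF k) ?_
    have hι : Fintype.card {i // i ≠ k} + 1 = Fintype.card ι := by
      rw [Fintype.card_subtype_compl, Fintype.card_subtype_eq]
      have : 0 < Fintype.card ι := Fintype.card_pos_iff.2 ⟨k⟩
      omega
    rw [Module.finrank_prod, Module.finrank_pi_fintype, Module.finrank_pi_fintype]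
    simp only [Finset.sum_const, Finset.card_univ, smul_eq_mul]
    rw [← hι]
    linarith
  have hcompl : ∀ᵐ c ∂μ, ∀ k, c ∉ Set.range (F k) :=
    ae_all_iff.2 fun k => measure_eq_zero_iff_ae_notMem.1 (hnull k)
  filter_upwards [hcompl] with c hc p hp h0
  obtain ⟨k, hk⟩ := Function.ne_iff.1 hp
  refine hc k ⟨(p, fun i => (a p k)⁻¹ • c i), funext fun i => ?_⟩
  by_cases h : i = k
  · subst h
    simp only [F, dite_true]
    rw [Fintype.sum_eq_add_sum_subtype_ne _ i, add_eq_zero_iff_eq_neg] at h0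
    have : ∑ j : {j // j ≠ i}, a p j • (a p i)⁻¹ • c j
        = (a p i)⁻¹ • ∑ j : {j // j ≠ i}, a p j • c j := by
      rw [Finset.smul_sum]
      exact Finset.sum_congr rfl fun j _ => smul_comm _ _ _
    rw [this, ← smul_neg, ← h0, smul_smul, inv_mul_cancel₀ hk, one_smul]
  · simp only [F, h, dite_false]
    rw [smul_smul, mul_inv_cancel₀ hk, one_smul]

/-! ### Kostlan coefficients and monomials -/

namespace RandomKnot

/-- The joint law of Kostlan coefficients is absolutely continuous. -/
theorem IsKostlanFamily.map_absolutelyContinuous {Ω : Type*} [MeasurableSpace Ω] {μ : Measure Ω}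
    [IsProbabilityMeasure μ] {m d k : ℕ} {ξ : MultiIndex m d → Ω → EuclideanSpace ℝ (Fin k)}
    (h : IsKostlanFamily μ ξ) : μ.map (fun ω α => ξ α ω) ≪ volume := by
  rw [(iIndepFun_iff_map_fun_eq_pi_map fun α => (h.hasLaw α).aemeasurable).1 h.indep, volume_pi]
  have (α : MultiIndex m d) : IsProbabilityMeasure (μ.map (ξ α)) :=
    Measure.isProbabilityMeasure_map (h.hasLaw α).aemeasurable
  refine Measure.AbsolutelyContinuous.pi fun α => ?_
  rw [(h.hasLaw α).map_eq]
  refine multivariateGaussian_absolutelyContinuous 0 (Matrix.PosDef.one.smul ?_)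
  exact_mod_cast Nat.multinomial_pos _ _

/-- Properties of almost all coefficient tuples hold almost surely for Kostlan coefficients. -/
theorem IsKostlanFamily.ae_of_ae_volume {Ω : Type*} [MeasurableSpace Ω] {μ : Measure Ω}
    [IsProbabilityMeasure μ] {m d k : ℕ} {ξ : MultiIndex m d → Ω → EuclideanSpace ℝ (Fin k)}
    (h : IsKostlanFamily μ ξ) {p : (MultiIndex m d → EuclideanSpace ℝ (Fin k)) → Prop}
    (hp : ∀ᵐ c, p c) : ∀ᵐ ω ∂μ, p fun α => ξ α ω :=
  ae_of_ae_map (aemeasurable_pi_lambda _ fun α => (h.hasLaw α).aemeasurable)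
    (h.map_absolutelyContinuous.ae_le hp)

/-- The vector of all monomials of degree `d` at the point `x`. -/
noncomputable def monomials {m : ℕ} (d : ℕ) (x : Fin (m + 1) → ℝ) (α : MultiIndex m d) : ℝ :=
  ∏ i, x i ^ α.1 i

theorem polyMap_eq_sum {m d k : ℕ} (c : MultiIndex m d → EuclideanSpace ℝ (Fin k))
    (x : Fin (m + 1) → ℝ) : polyMap c x = ∑ α, monomials d x α • c α := rfl

theorem contDiff_monomials {m d : ℕ} {n : WithTop ℕ∞} :
    ContDiff ℝ n (monomials d : (Fin (m + 1) → ℝ) → MultiIndex m d → ℝ) :=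
  contDiff_pi.2 fun α => by unfold monomials; fun_prop

theorem contDiff_polyMap {m d k : ℕ} {n : WithTop ℕ∞}
    (c : MultiIndex m d → EuclideanSpace ℝ (Fin k)) : ContDiff ℝ n (polyMap c) := by
  unfold polyMap
  fun_prop

/-- The multi-index of `x_i ^ (d - 1) * x_k`. -/
noncomputable def mixedIndex {m d : ℕ} (hd : 1 ≤ d) (i k : Fin (m + 1)) : MultiIndex m d :=
  ⟨Finsupp.single i (d - 1) + Finsupp.single k 1, by
    rw [Finset.mem_finsuppAntidiag]
    refine ⟨?_, Finset.subset_univ _⟩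
    change ∑ j, (Finsupp.single i (d - 1) + Finsupp.single k 1 : Fin (m + 1) →₀ ℕ) j = d
    simp only [Finsupp.add_apply, Finset.sum_add_distrib, Finsupp.single_apply,
      Finset.sum_ite_eq, Finset.mem_univ, if_true]
    omega⟩

theorem monomials_mixedIndex {m d : ℕ} (hd : 1 ≤ d) (i k : Fin (m + 1)) (x : Fin (m + 1) → ℝ) :
    monomials d x (mixedIndex hd i k) = x i ^ (d - 1) * x k := by
  simp only [monomials, mixedIndex, Finsupp.add_apply, pow_add, Finset.prod_mul_distrib,
    Finsupp.single_apply, pow_ite, pow_zero, Finset.prod_ite_eq, Finset.mem_univ, if_true, pow_one]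

theorem monomials_ne_zero {m d : ℕ} (hd : 1 ≤ d) {x : Fin (m + 1) → ℝ} (hx : x ≠ 0) :
    monomials d x ≠ 0 := by
  obtain ⟨i, hi⟩ := Function.ne_iff.1 hx
  refine Function.ne_iff.2 ⟨mixedIndex hd i i, ?_⟩
  rw [monomials_mixedIndex]
  exact mul_ne_zero (pow_ne_zero _ hi) hi

/-- Once `x i ≠ 0`, the entries `x i ^ (d - 1) * x k`, as `k` varies, form a nonzero multiple of
`x`; the same entries for `y` form a multiple of `y`. -/
theorem exists_smul_eq_of_monomials_eq_smul {m d : ℕ} (hd : 1 ≤ d) {x y : Fin (m + 1) → ℝ}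
    {t : ℝ} (hx : x ≠ 0) (h : monomials d x = t • monomials d y) : ∃ r : ℝ, r • y = x := by
  obtain ⟨i, hi⟩ := Function.ne_iff.1 hx
  have hk (k : Fin (m + 1)) : x i ^ (d - 1) * x k = t * (y i ^ (d - 1) * y k) := by
    simpa only [Pi.smul_apply, monomials_mixedIndex, smul_eq_mul] using
      congrFun h (mixedIndex hd i k)
  have hi' : x i ^ (d - 1) ≠ 0 := pow_ne_zero _ hi
  refine ⟨t * y i ^ (d - 1) / x i ^ (d - 1), funext fun k => ?_⟩
  rw [Pi.smul_apply, smul_eq_mul, div_mul_eq_mul_div, div_eq_iff hi']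
  linarith [hk k]

/-- `ae_forall_sum_smul_ne_zero` for coefficient tuples of polynomial maps. -/
theorem ae_forall_sum_monomials_ne_zero {V : Type*} [NormedAddCommGroup V] [NormedSpace ℝ V]
    [FiniteDimensional ℝ V] {m d k : ℕ} {a : V → MultiIndex m d → ℝ} (ha : ContDiff ℝ 1 a)
    (hdim : Module.finrank ℝ V < k) :
    ∀ᵐ c : MultiIndex m d → EuclideanSpace ℝ (Fin k), ∀ p, a p ≠ 0 → ∑ α, a p α • c α ≠ 0 :=
  ae_forall_sum_smul_ne_zero volume ha (by rwa [finrank_euclideanSpace_fin])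

/-! ### The Kostlan knot -/

theorem continuous_rescaledMap {m d k : ℕ} (c : MultiIndex m d → EuclideanSpace ℝ (Fin k)) :
    Continuous (rescaledMap c) := by
  refine (contDiff_polyMap (n := 1) c).continuous.comp (continuous_pi fun i => ?_)
  refine Fin.cases ?_ (fun j => ?_) i
  · simpa using continuous_const
  · simp only [Fin.cons_succ]
    fun_prop

/-- The point of the affine plane over the point of angle `s` of the rescaled unit circle. -/
noncomputable def circlePoint (d : ℕ) (s : ℝ) : Fin (2 + 1) → ℝ :=
  ![1, Real.cos s / √(d : ℝ), Real.sin s / √(d : ℝ)]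

theorem contDiff_circlePoint (d : ℕ) {n : WithTop ℕ∞} : ContDiff ℝ n (circlePoint d) := by
  refine contDiff_pi.2 fun i => ?_
  fin_cases i <;> simp [circlePoint] <;> fun_prop

/-- Polar coordinates in the plane. -/
theorem exists_polar (a b : ℝ) :
    ∃ s, a = √(a ^ 2 + b ^ 2) * Real.cos s ∧ b = √(a ^ 2 + b ^ 2) * Real.sin s := by
  have h : √(a ^ 2 + b ^ 2) = ‖(⟨a, b⟩ : ℂ)‖ := by
    rw [Complex.norm_def, Complex.normSq_mk]; ring_nf
  exact ⟨Complex.arg ⟨a, b⟩, by rw [h, Complex.norm_mul_cos_arg],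
    by rw [h, Complex.norm_mul_sin_arg]⟩

theorem ae_injOn_sphere_rescaledMap {d k : ℕ} (hd : 1 ≤ d) (hk : 2 < k) :
    ∀ᵐ c : MultiIndex 2 d → EuclideanSpace ℝ (Fin k),
      Set.InjOn (rescaledMap c) (Metric.sphere (0 : EuclideanSpace ℝ (Fin 2)) 1) := by
  have ha : ContDiff ℝ 1 fun p : ℝ × ℝ =>
      monomials d (circlePoint d p.1) - monomials d (circlePoint d p.2) :=
    (contDiff_monomials.comp ((contDiff_circlePoint d).comp contDiff_fst)).sub
      (contDiff_monomials.comp ((contDiff_circlePoint d).comp contDiff_snd))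
  have hsqrt : √(d : ℝ) ≠ 0 := (Real.sqrt_pos.2 (by exact_mod_cast hd)).ne'
  filter_upwards [ae_forall_sum_monomials_ne_zero (k := k) ha (by simpa using hk)]
    with c hc u hu v hv huv
  have hpt (w : EuclideanSpace ℝ (Fin 2)) (hw : w ∈ Metric.sphere 0 1) : ∃ s,
      (Fin.cons 1 fun i => w i / √(d : ℝ) : Fin (2 + 1) → ℝ) = circlePoint d s := by
    have hw1 : √(w 0 ^ 2 + w 1 ^ 2) = 1 := by
      simpa [EuclideanSpace.norm_eq, Fin.sum_univ_two] using hw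
    obtain ⟨s, h0, h1⟩ := exists_polar (w 0) (w 1)
    rw [hw1, one_mul] at h0 h1
    refine ⟨s, funext fun i => ?_⟩
    fin_cases i
    · rfl
    · simp [circlePoint, ← h0]
    · change w 1 / _ = Real.sin s / _
      rw [h1]
  obtain ⟨s, hs⟩ := hpt u hu
  obtain ⟨t, ht⟩ := hpt v hv
  have hst : monomials d (circlePoint d s) = monomials d (circlePoint d t) := by
    by_contra hne
    refine hc (s, t) (sub_ne_zero.2 hne) ?_
    simp only [Pi.sub_apply, sub_smul, Finset.sum_sub_distrib, ← polyMap_eq_sum]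
    rw [← hs, ← ht]
    exact sub_eq_zero.2 huv
  ext i
  -- Where `x 0 = 1`, this monomial is the coordinate itself.
  have h := congrFun hst (mixedIndex hd 0 i.succ)
  rw [← hs, ← ht, monomials_mixedIndex, monomials_mixedIndex] at h
  simpa [div_left_inj' hsqrt] using h

theorem ae_isEmbedding_rescaledMap {d k : ℕ} (hd : 1 ≤ d) (hk : 2 < k) :
    ∀ᵐ c : MultiIndex 2 d → EuclideanSpace ℝ (Fin k),
      IsEmbedding (fun u : Metric.sphere (0 : EuclideanSpace ℝ (Fin 2)) 1 =>
        rescaledMap c (u : EuclideanSpace ℝ (Fin 2))) := by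
  filter_upwards [ae_injOn_sphere_rescaledMap hd hk] with c hc
  exact ((continuous_rescaledMap c).comp continuous_subtype_val).isClosedEmbedding
    (Set.injOn_iff_injective.1 hc) |>.isEmbedding

/-! ### Rational curves -/

theorem ae_polyMap_ne_zero {m d k : ℕ} (hd : 1 ≤ d) (hk : m + 1 < k) :
    ∀ᵐ c : MultiIndex m d → EuclideanSpace ℝ (Fin k), ∀ x, x ≠ 0 → polyMap c x ≠ 0 := by
  filter_upwards [ae_forall_sum_monomials_ne_zero (k := k) (contDiff_monomials (m := m) (d := d))
    (by simpa using hk)] with c hc x hx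
  exact hc x (monomials_ne_zero hd hx)

/-- For almost every coefficient tuple, two points of the plane with proportional images are
proportional. -/
theorem ae_polyMap_injective {d k : ℕ} (hd : 1 ≤ d) (hk : 3 < k) :
    ∀ᵐ c : MultiIndex 1 d → EuclideanSpace ℝ (Fin k), ∀ x y : Fin (1 + 1) → ℝ, x ≠ 0 → y ≠ 0 →
      (∃ t : ℝ, polyMap c x = t • polyMap c y) → ∃ r : ℝ, r • y = x := by
  let γ (s : ℝ) : Fin (1 + 1) → ℝ := ![Real.cos s, Real.sin s]
  have hγ : ContDiff ℝ 1 γ := by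
    refine contDiff_pi.2 fun i => ?_
    fin_cases i <;> simp [γ] <;> fun_prop
  -- Homogeneity absorbs the radii of both points into the ratio, leaving three parameters instead
  -- of five.
  have ha : ContDiff ℝ 1 fun p : ℝ × ℝ × ℝ =>
      monomials d (γ p.1) - p.2.2 • monomials d (γ p.2.1) :=
    (contDiff_monomials.comp (hγ.comp contDiff_fst)).sub
      ((contDiff_snd.comp contDiff_snd).smul
        (contDiff_monomials.comp (hγ.comp (contDiff_fst.comp contDiff_snd))))
  have hpolar (x : Fin (1 + 1) → ℝ) (hx : x ≠ 0) : ∃ r s : ℝ, r ≠ 0 ∧ x = r • γ s := by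
    obtain ⟨s, h0, h1⟩ := exists_polar (x 0) (x 1)
    have hxs : x = √(x 0 ^ 2 + x 1 ^ 2) • γ s := by
      ext i
      fin_cases i
      · exact h0
      · exact h1
    exact ⟨√(x 0 ^ 2 + x 1 ^ 2), s, fun h => hx (by rw [hxs, h, zero_smul]), hxs⟩
  have hγ0 (s : ℝ) : γ s ≠ 0 := fun h => by
    have h0 : Real.cos s = 0 := congrFun h 0
    have h1 : Real.sin s = 0 := congrFun h 1
    simpa [h0, h1] using Real.sin_sq_add_cos_sq s
  filter_upwards [ae_forall_sum_monomials_ne_zero (k := k) ha (by simpa using hk)]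
    with c hc x y hx hy ⟨l, hl⟩
  obtain ⟨r, s, hr, rfl⟩ := hpolar x hx
  obtain ⟨q, t, hq, rfl⟩ := hpolar y hy
  have heq : monomials d (γ s) = ((r ^ d)⁻¹ * l * q ^ d) • monomials d (γ t) := by
    by_contra hne
    refine hc (s, t, (r ^ d)⁻¹ * l * q ^ d) (sub_ne_zero.2 hne) ?_
    simp only [Pi.sub_apply, Pi.smul_apply, sub_smul, smul_eq_mul, mul_smul,
      Finset.sum_sub_distrib, ← Finset.smul_sum, ← polyMap_eq_sum]
    rw [polyMap_smul, polyMap_smul] at hl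
    rw [sub_eq_zero, ← hl, smul_smul, inv_mul_cancel₀ (pow_ne_zero d hr), one_smul]
  obtain ⟨w, hw⟩ := exists_smul_eq_of_monomials_eq_smul hd (hγ0 s) heq
  refine ⟨r * w * q⁻¹, ?_⟩
  rw [← hw, smul_smul, smul_smul, mul_assoc, inv_mul_cancel₀ hq, mul_one]

/-- The curve `s ↦ (1, s)` or `s ↦ (s, 1)`, the affine line whose `i`-th coordinate is `1`. -/
noncomputable def affineLine (i : Fin (1 + 1)) (s : ℝ) : Fin (1 + 1) → ℝ :=
  i.insertNth (α := fun _ => ℝ) 1 fun _ => s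

theorem contDiff_affineLine (i : Fin (1 + 1)) {n : WithTop ℕ∞} :
    ContDiff ℝ n (affineLine i) := by
  refine contDiff_pi.2 fun j => ?_
  refine Fin.succAboveCases i ?_ (fun l => ?_) j
  · simpa [affineLine] using contDiff_const
  · simpa [affineLine] using contDiff_fun_id

/-- A velocity parallel to the position vector is what a vanishing differential of the projective
curve means upstairs. -/
theorem ae_deriv_polyMap_affineLine_ne_smul {d k : ℕ} (hd : 1 ≤ d) (hk : 2 < k)
    (i : Fin (1 + 1)) :
    ∀ᵐ c : MultiIndex 1 d → EuclideanSpace ℝ (Fin k), ∀ s l : ℝ,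
      deriv (fun s => polyMap c (affineLine i s)) s ≠ l • polyMap c (affineLine i s) := by
  have hm {n : WithTop ℕ∞} : ContDiff ℝ n fun s => monomials d (affineLine i s) :=
    contDiff_monomials.comp (contDiff_affineLine i)
  have hm' : ContDiff ℝ 1 (deriv fun s => monomials d (affineLine i s)) :=
    ((contDiff_succ_iff_deriv (n := 1)).1 (hm (n := 1 + 1))).2.2
  have ha : ContDiff ℝ 1 fun p : ℝ × ℝ => deriv (fun s => monomials d (affineLine i s)) p.1 -
      p.2 • monomials d (affineLine i p.1) :=
    (hm'.comp contDiff_fst).sub (contDiff_snd.smul (hm.comp contDiff_fst))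
  have hda (s : ℝ) (α : MultiIndex 1 d) : HasDerivAt (fun s => monomials d (affineLine i s) α)
      (deriv (fun s => monomials d (affineLine i s)) s α) s :=
    hasDerivAt_pi.1 (hm (n := 1).differentiable one_ne_zero s).hasDerivAt α
  filter_upwards [ae_forall_sum_monomials_ne_zero (k := k) ha (by simpa using hk)]
    with c hc s l heq
  have hderiv : deriv (fun s => polyMap c (affineLine i s)) s =
      ∑ α, deriv (fun s => monomials d (affineLine i s)) s α • c α :=
    (HasDerivAt.fun_sum fun α _ => (hda s α).smul_const (c α)).deriv
  refine hc (s, l) (fun h0 => ?_) ?_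
  -- The monomials restricting to `1` and `s` settle nontriviality: the first forces `l = 0`, and
  -- the second then reads `1 = 0`.
  · have hi : (fun s => monomials d (affineLine i s) (mixedIndex hd i i)) = fun _ => 1 := by
      funext s
      simp [monomials_mixedIndex, affineLine]
    have hj : (fun s => monomials d (affineLine i s) (mixedIndex hd i (i.succAbove 0)))
        = fun s => s := by
      funext s
      simp [monomials_mixedIndex, affineLine]
    have hi' := hda s (mixedIndex hd i i)
    have hj' := hda s (mixedIndex hd i (i.succAbove 0))
    have ei := congrFun h0 (mixedIndex hd i i)
    have ej := congrFun h0 (mixedIndex hd i (i.succAbove 0))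
    simp only [Pi.sub_apply, Pi.smul_apply, smul_eq_mul, Pi.zero_apply] at ei ej
    rw [hi] at hi'
    rw [hj] at hj'
    rw [hi'.unique (hasDerivAt_const s 1), congrFun hi s] at ei
    rw [hj'.unique (hasDerivAt_id' s), congrFun hj s] at ej
    have : l = 0 := by linarith
    simp [this] at ej
  · simp only [Pi.sub_apply, Pi.smul_apply, sub_smul, smul_eq_mul, mul_smul,
      Finset.sum_sub_distrib, ← Finset.smul_sum, ← polyMap_eq_sum]
    rw [← hderiv, heq, sub_self]

/-! ### Topology of real projective space -/

theorem continuous_projectivization_mk (n : ℕ) :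
    Continuous fun v : {v : Fin (n + 1) → ℝ // v ≠ 0} =>
      (Projectivization.mk ℝ v.1 v.2 : RealProj n) :=
  continuous_quot_mk

/-- The entry `y_i y_j / ∑ y_l ^ 2` of the orthogonal projection onto the line `[y]`. -/
noncomputable def lineProjection {n : ℕ} : RealProj n → Fin (n + 1) → Fin (n + 1) → ℝ :=
  Projectivization.lift (fun v i j => v.1 i * v.1 j / ∑ l, v.1 l ^ 2) fun a b t h => by
    have ht : t ≠ 0 := by
      rintro rfl
      exact a.2 (by simpa using h)
    funext i j
    simp only [h, Pi.smul_apply, smul_eq_mul, mul_pow, ← Finset.mul_sum]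
    rw [mul_mul_mul_comm, ← pow_two, mul_div_mul_left _ _ (pow_ne_zero 2 ht)]

theorem sum_sq_ne_zero {n : ℕ} {v : Fin (n + 1) → ℝ} (hv : v ≠ 0) : ∑ l, v l ^ 2 ≠ 0 := by
  obtain ⟨i, hi⟩ := Function.ne_iff.1 hv
  exact (Finset.sum_pos' (fun l _ => sq_nonneg (v l))
    ⟨i, Finset.mem_univ i, by have : v i ≠ 0 := hi; positivity⟩).ne'

theorem continuous_lineProjection (n : ℕ) : Continuous (lineProjection (n := n)) := by
  refine Continuous.quotient_lift (continuous_pi fun i => continuous_pi fun j => ?_) _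
  have hv (l : Fin (n + 1)) : Continuous fun v : {v : Fin (n + 1) → ℝ // v ≠ 0} => v.1 l :=
    (continuous_apply l).comp continuous_subtype_val
  exact Continuous.div ((hv i).mul (hv j)) (continuous_finsetSum _ fun l _ => (hv l).pow 2)
    fun v => sum_sq_ne_zero v.2

/-- Row `i` of the projection matrix is a multiple of `v`, nonzero when `v i ≠ 0`, so the matrix
determines the line. This is what makes `RealProj n` Hausdorff. -/
theorem lineProjection_injective (n : ℕ) : Function.Injective (lineProjection (n := n)) := by
  intro p q h
  induction p using Projectivization.ind with | h v hv =>
  induction q using Projectivization.ind with | h w hw =>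
  obtain ⟨i, hi⟩ := Function.ne_iff.1 hv
  have hi : v i ≠ 0 := hi
  have hS := sum_sq_ne_zero hv
  have hT := sum_sq_ne_zero hw
  refine (Projectivization.mk_eq_mk_iff' ..).2
    ⟨w i / (∑ l, w l ^ 2) * (∑ l, v l ^ 2) / v i, funext fun j => ?_⟩
  have hij : v i * v j / ∑ l, v l ^ 2 = w i * w j / ∑ l, w l ^ 2 := congrFun (congrFun h i) j
  rw [div_eq_div_iff hS hT] at hij
  rw [Pi.smul_apply, smul_eq_mul]
  field_simp
  linarith

instance (n : ℕ) : T2Space (RealProj n) :=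
  .of_injective_continuous (lineProjection_injective n) (continuous_lineProjection n)

instance (n : ℕ) : CompactSpace (RealProj n) := by
  let g (v : Metric.sphere (0 : Fin (n + 1) → ℝ) 1) : RealProj n :=
    Projectivization.mk ℝ v.1 (ne_zero_of_mem_unit_sphere v)
  have hg : Continuous g :=
    (continuous_projectivization_mk n).comp
      (continuous_subtype_val.subtype_mk fun v => ne_zero_of_mem_unit_sphere v)
  have hs : Function.Surjective g := by
    intro p
    induction p using Projectivization.ind with | h v hv =>
    refine ⟨⟨‖v‖⁻¹ • v, ?_⟩, ?_⟩
    · rw [mem_sphere_zero_iff_norm]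
      exact norm_smul_inv_norm (𝕜 := ℝ) hv
    · exact (Projectivization.mk_eq_mk_iff' ..).2 ⟨‖v‖⁻¹, rfl⟩
  exact hs.compactSpace hg

/-! ### Rational curves in projective space -/

section RationalMap

variable {m d k : ℕ} {c : MultiIndex m d → EuclideanSpace ℝ (Fin (k + 1))}
  (hc : ∀ x : Fin (m + 1) → ℝ, x ≠ 0 → polyMap c x ≠ 0)

theorem continuous_rationalMap : Continuous (rationalMap c hc) := by
  refine Continuous.quotient_lift ?_ _
  have hP : Continuous (polyMap c) := (contDiff_polyMap (n := 1) c).continuous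
  have hP' : Continuous fun v : {v : Fin (m + 1) → ℝ // v ≠ 0} => (polyMap c v.1).ofLp :=
    (PiLp.continuous_ofLp 2 _).comp (hP.comp continuous_subtype_val)
  exact (continuous_projectivization_mk k).comp (hP'.subtype_mk fun v h =>
    hc v.1 v.2 (by ext j; exact congrFun h j))

theorem rationalMap_injective
    (h : ∀ x y : Fin (m + 1) → ℝ, x ≠ 0 → y ≠ 0 →
      (∃ t : ℝ, polyMap c x = t • polyMap c y) → ∃ r : ℝ, r • y = x) :
    Function.Injective (rationalMap c hc) := by
  intro p q hpq
  induction p using Projectivization.ind with | h v hv =>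
  induction q using Projectivization.ind with | h w hw =>
  obtain ⟨t, ht⟩ := (Projectivization.mk_eq_mk_iff' ..).1 hpq
  refine (Projectivization.mk_eq_mk_iff' ..).2 (h v w hv hw ⟨t, ?_⟩)
  ext j
  exact (congrFun ht j).symm

theorem affineCoord_rationalMap_affineParam (i : Fin (m + 1)) (j : Fin (k + 1)) (v : Fin m → ℝ) :
    affineCoord j (rationalMap c hc (affineParam i v)) = fun l =>
      polyMap c (i.insertNth (α := fun _ => ℝ) 1 v) (j.succAbove l) /
        polyMap c (i.insertNth (α := fun _ => ℝ) 1 v) j := rfl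

theorem polyMap_ne_zero_of_mem_range {i : Fin (m + 1)} {j : Fin (k + 1)} {u : Fin m → ℝ}
    (h : rationalMap c hc (affineParam i u) ∈ Set.range (affineParam j)) :
    polyMap c (i.insertNth (α := fun _ => ℝ) 1 u) j ≠ 0 := by
  obtain ⟨w, hw⟩ := h
  obtain ⟨t, ht⟩ := (Projectivization.mk_eq_mk_iff' ..).1 hw
  have := congrFun ht j
  simp only [Pi.smul_apply, smul_eq_mul, Fin.insertNth_apply_same] at this
  intro h0
  rw [h0, mul_zero] at this
  exact zero_ne_one this

theorem contDiff_insertNth (i : Fin (m + 1)) {n : WithTop ℕ∞} :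
    ContDiff ℝ n fun v : Fin m → ℝ => i.insertNth (α := fun _ => ℝ) 1 v := by
  refine contDiff_pi.2 fun j => ?_
  refine Fin.succAboveCases i ?_ (fun l => ?_) j
  · simpa using contDiff_const
  · simpa using contDiff_apply ℝ ℝ l

theorem contDiffAt_rationalMap {i : Fin (m + 1)} {j : Fin (k + 1)} {u : Fin m → ℝ}
    {n : WithTop ℕ∞}
    (h : rationalMap c hc (affineParam i u) ∈ Set.range (affineParam j)) :
    ContDiffAt ℝ n (fun v => affineCoord j (rationalMap c hc (affineParam i v))) u := by
  have hP : ContDiff ℝ n fun v : Fin m → ℝ => polyMap c (i.insertNth (α := fun _ => ℝ) 1 v) :=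
    (contDiff_polyMap c).comp (contDiff_insertNth i)
  have hP' (l : Fin (k + 1)) : ContDiff ℝ n fun v : Fin m → ℝ =>
      polyMap c (i.insertNth (α := fun _ => ℝ) 1 v) l := by fun_prop
  simp only [affineCoord_rationalMap_affineParam]
  exact contDiffAt_pi.2 fun l =>
    (hP' _).contDiffAt.div (hP' _).contDiffAt (polyMap_ne_zero_of_mem_range hc h)

end RationalMap

/-- By the quotient rule, if all `g l / g j` have zero derivative at `s`, then the velocity of `g`
there is a multiple of `g s`. -/
theorem fderiv_rationalMap_injective {d k : ℕ}
    {c : MultiIndex 1 d → EuclideanSpace ℝ (Fin (k + 1))}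
    (hc : ∀ x : Fin (1 + 1) → ℝ, x ≠ 0 → polyMap c x ≠ 0) {i : Fin (1 + 1)} {j : Fin (k + 1)}
    {u : Fin 1 → ℝ}
    (himm : ∀ s l : ℝ,
      deriv (fun s => polyMap c (affineLine i s)) s ≠ l • polyMap c (affineLine i s))
    (h : rationalMap c hc (affineParam i u) ∈ Set.range (affineParam j)) :
    Function.Injective
      (fderiv ℝ (fun v => affineCoord j (rationalMap c hc (affineParam i v))) u) := by
  set f := fun v => affineCoord j (rationalMap c hc (affineParam i v)) with hf
  have hdf : DifferentiableAt ℝ f u :=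
    (contDiffAt_rationalMap (n := 1) hc h).differentiableAt one_ne_zero
  refine (injective_iff_map_eq_zero _).2 fun w hw => ?_
  by_contra hw0
  have hconst (v : Fin 1 → ℝ) : v = fun _ => v 0 := funext fun l => by rw [Subsingleton.elim l 0]
  have hone : fderiv ℝ f u (fun _ => 1) = 0 := by
    have hw' : w = w 0 • (fun _ => 1) := by
      rw [hconst w]
      ext
      simp
    have : w 0 ≠ 0 := fun h => hw0 (by rw [hconst w, h]; rfl)
    rw [hw', map_smul] at hw
    exact (smul_eq_zero.1 hw).resolve_left this
  set s := u 0
  have hu : u = fun _ => s := hconst u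
  set g := fun s => polyMap c (affineLine i s) with hg
  have hgd : HasDerivAt g (deriv g s) s :=
    (((contDiff_polyMap (n := 1) c).comp (contDiff_affineLine i)).differentiable
      one_ne_zero s).hasDerivAt
  have hgl (l : Fin (k + 1)) : HasDerivAt (fun s => g s l) (deriv g s l) s :=
    (EuclideanSpace.proj l : EuclideanSpace ℝ (Fin (k + 1)) →L[ℝ] ℝ).hasFDerivAt.comp_hasDerivAt
      s hgd
  have hgj : g s j ≠ 0 := by
    have := polyMap_ne_zero_of_mem_range hc h
    rwa [hu] at this
  have hline : HasDerivAt (fun s : ℝ => f fun _ => s) 0 s := by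
    have h1 : HasFDerivAt f (fderiv ℝ f u) (fun _ => s) := by
      rw [← hu]
      exact hdf.hasFDerivAt
    have h2 : HasDerivAt (fun (s : ℝ) (_ : Fin 1) => s) (fun _ => 1) s :=
      hasDerivAt_pi.2 fun _ => hasDerivAt_id' s
    have h3 := h1.comp_hasDerivAt s h2
    rw [hone] at h3
    exact h3
  -- The factor is dictated by the `j`-th coordinate.
  refine himm s (deriv g s j / g s j) ?_
  ext l
  rw [PiLp.smul_apply, smul_eq_mul]
  by_cases hlj : l = j
  · subst hlj
    exact (div_mul_cancel₀ _ hgj).symm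
  · obtain ⟨l, rfl⟩ := Fin.exists_succAbove_eq hlj
    have h3 := ((hgl (j.succAbove l)).div (hgl j) hgj).unique (hasDerivAt_pi.1 hline l)
    have h4 := (div_eq_zero_iff.1 h3).resolve_right (pow_ne_zero 2 hgj)
    change deriv g s _ = _ * g s _
    field_simp
    linarith

theorem ae_isSmoothEmbedding_rationalMap {d k : ℕ} (hd : 1 ≤ d) (hk : 3 ≤ k) :
    ∀ᵐ c : MultiIndex 1 d → EuclideanSpace ℝ (Fin (k + 1)),
      ∃ hc : ∀ x : Fin (1 + 1) → ℝ, x ≠ 0 → polyMap c x ≠ 0,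
        IsSmoothEmbedding (rationalMap c hc) := by
  filter_upwards [ae_polyMap_ne_zero (m := 1) (k := k + 1) hd (by omega),
    ae_polyMap_injective (k := k + 1) hd (by omega),
    ae_all_iff.2 (ae_deriv_polyMap_affineLine_ne_smul (k := k + 1) hd (by omega))]
    with c hc hinj himm
  exact ⟨hc,
    ((continuous_rationalMap hc).isClosedEmbedding (rationalMap_injective hc hinj)).isEmbedding,
    fun _ _ _ h => contDiffAt_rationalMap hc h,
    fun i _ _ h => fderiv_rationalMap_injective hc (himm i) h⟩

end RandomKnot

theorem mainTheorem9 {Ω : Type*} [MeasurableSpace Ω] (μ : Measure Ω) [IsProbabilityMeasure μ]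
    (d : ℕ) (hd : 1 ≤ d) :
    (∀ ξ : RandomKnot.MultiIndex 2 d → Ω → EuclideanSpace ℝ (Fin 3),
      RandomKnot.IsKostlanFamily μ ξ →
        ∀ᵐ ω ∂μ, IsEmbedding
          (fun u : Metric.sphere (0 : EuclideanSpace ℝ (Fin 2)) 1 =>
            RandomKnot.rescaledMap (fun α => ξ α ω) (u : EuclideanSpace ℝ (Fin 2)))) ∧
    (∀ η : RandomKnot.MultiIndex 1 d → Ω → EuclideanSpace ℝ (Fin 4),
      RandomKnot.IsKostlanFamily μ η →
        ∀ᵐ ω ∂μ,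
          ∃ hc : ∀ x : Fin (1 + 1) → ℝ, x ≠ 0 → RandomKnot.polyMap (fun α => η α ω) x ≠ 0,
            RandomKnot.IsSmoothEmbedding (m := 1) (k := 3)
              (RandomKnot.rationalMap (k := 3) (fun α => η α ω) hc)) :=
  ⟨fun _ hξ => hξ.ae_of_ae_volume (RandomKnot.ae_isEmbedding_rescaledMap hd (by norm_num)),
    fun _ hη => hη.ae_of_ae_volume (RandomKnot.ae_isSmoothEmbedding_rationalMap hd le_rfl)⟩
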